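/- A \emph{partial action} of a group $G$ on a set $X$ is a partially defined function $\eta\colon G\times X\rightharpoonup X$, $(g,x)\mapsto g\cdot x$, with domain denoted $G*X\subseteq G\times X$, such that for all $g,h\in G$ and $x\in X$: (PA1) if $g\cdot x$ is defined, then $g^{-1}\cdot(g\cdot x)$ is defined and equals $x$; (PA2) if $g\cdot(h\cdot x)$ is defined, then $(gh)\cdot x$ is defined and $g\cdot(h\cdot x)=(gh)\cdot x$; (PA3) $1\cdot x$ is defined and equals $x$. Put $X_g=\{x\in X : g^{-1}\cdot x \text{ is defined}\}$ and $\eta_g\colon X_{g^{-1}}\to X_g$, $x\mapsto g\cdot x$. If $G$ is a topological group and $X$ a topological space, $\eta$ is \emph{topological} if every $X_g$ is open in $X$ and every $\eta_g$ is a homeomorphism, and \emph{continuous} if $\eta\colon G*X\to X$ is continuous for the subspace topology on $G*X\subseteq G\times X$. For a subgroup $H$ of $G$, let $x\sim_H y$ iff there is $h\in H$ such that $h\cdot x$ is defined and equal to $y$; the orbit space $X/\!\sim_H$ carries the quotient topology. The enveloping space is $X_G=(G\times X)/R$, where $(g,x)\,R\,(h,y)$ iff $(h^{-1}g)\cdot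 x$ is defined and equal to $y$; write $[g,x]$ for the class of $(g,x)$. The group $G$ acts globally on $X_G$ by $g[h,x]=[gh,x]$. Let $H[g,x]$ denote the $H$-orbit of $[g,x]$ and let $X_G/\!\sim_H$ be the set of these orbits. The map $\varphi\colon X/\!\sim_H\to X_G/\!\sim_H$ sending the class of $x$ to $H[1,x]$ is well defined and injective. If $H$ is normal, $G/H$ acts globally on $X_G/\!\sim_H$ by $\mu_{gH}(H[t,x])=H[gt,x]$, and $\eta_{G/H}$ denotes the partial action of $G/H$ on $X/\!\sim_H$ for which $gH\cdot z$ is defined iff $\mu_{gH}(\varphi(z))\in\operatorname{Im}\varphi$, and then $gH\cdot z=\varphi^{-1}(\mu_{gH}(\varphi(z)))$. Its domain is denoted $G/H*(X/\!\sim_H)$. \textbf{Statement.} Let $G$ be a compact Hausdorff topological group, $H$ a closed normal subgroup of $G$, and $\eta$ a continuous topological partial action of $G$ on a compact Hausdorff space $X$ such that $G*X$ is closed in $G\times X$. Then $G/H*(X/\!\sim_H)$ is closed in $G/H\times (X/\!\sim_H)$, where $G/H$ and $X/\!\sim_H$ carry the quotient topologies. -/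

import Mathlib

/-- A partial action of a group `G` on a set `X`: a partially defined function
`η : G × X ⇀ X`, `(g, x) ↦ g · x`, satisfying (PA1)-(PA3). Here `y ∈ η.toPFun (g, x)` means
that `g · x` is defined and equal to `y`. -/
structure PartialAction (G : Type*) (X : Type*) [Group G] where
  /-- the underlying partial function -/
  toPFun : G × X →. X
  /-- (PA1): if `g · x` is defined, then `g⁻¹ · (g · x)` is defined and equal to `x` -/
  inv_act : ∀ (g : G) (x y : X), y ∈ toPFun (g, x) → x ∈ toPFun (g⁻¹, y)
  /-- (PA2): if `g · (h · x)` is defined, then `(g h) · x` is defined and they are equal -/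
  mul_act : ∀ (g h : G) (x y z : X),
    y ∈ toPFun (h, x) → z ∈ toPFun (g, y) → z ∈ toPFun (g * h, x)
  /-- (PA3): `1 · x` is defined and equal to `x` -/
  one_act : ∀ x : X, x ∈ toPFun (1, x)

namespace PartialAction

section Basic

variable {G : Type*} {X : Type*} [Group G]

/-- The domain `G * X ⊆ G × X` of a partial action. -/
def dom (η : PartialAction G X) : Set (G × X) := η.toPFun.Dom

/-- The set `X_g = {x | g⁻¹ · x is defined}`. -/
def dom_at (η : PartialAction G X) (g : G) : Set X := {x | (g⁻¹, x) ∈ η.dom}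

theorem mem_dom_iff (η : PartialAction G X) (p : G × X) :
    p ∈ η.dom ↔ ∃ y, y ∈ η.toPFun p :=
  PFun.mem_dom _ _

/-- The map `η : G * X → X`. -/
def act (η : PartialAction G X) : η.dom → X := η.toPFun.asSubtype

theorem act_mem (η : PartialAction G X) (p : η.dom) : η.act p ∈ η.toPFun p.1 :=
  Part.get_mem p.2

/-- The map `η_g : X_{g⁻¹} → X_g`, `x ↦ g · x`. -/
def actAt (η : PartialAction G X) (g : G) : η.dom_at g⁻¹ → η.dom_at g := fun x =>
  have hx : (g, x.1) ∈ η.dom := by simpa [dom_at] using x.2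
  ⟨η.act ⟨(g, x.1), hx⟩,
    (η.mem_dom_iff _).2 ⟨x.1, η.inv_act _ _ _ (η.act_mem ⟨(g, x.1), hx⟩)⟩⟩

/-- A partial action of a topological group on a space is topological if every `X_g` is open and
every `η_g : X_{g⁻¹} → X_g` is a homeomorphism. -/
structure IsTopological [TopologicalSpace X] (η : PartialAction G X) : Prop where
  isOpen_dom_at : ∀ g : G, IsOpen (η.dom_at g)
  isHomeomorph_actAt : ∀ g : G, IsHomeomorph (η.actAt g)

/-- A partial action is continuous if `η : G * X → X` is continuous, where `G * X` has the
topology of a subspace of `G × X`. -/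
def IsContinuous [TopologicalSpace G] [TopologicalSpace X] (η : PartialAction G X) : Prop :=
  Continuous η.act

/-- The orbit equivalence relation `∼_G` of a partial action: `x ∼_G y` iff `g · x = y` for some
`g` such that `g · x` is defined. -/
def orbitSetoid (η : PartialAction G X) : Setoid X where
  r x y := ∃ g : G, y ∈ η.toPFun (g, x)
  iseqv :=
    { refl := fun x => ⟨1, η.one_act x⟩
      symm := fun ⟨g, h⟩ => ⟨g⁻¹, η.inv_act _ _ _ h⟩
      trans := fun ⟨g, h⟩ ⟨g', h'⟩ => ⟨g' * g, η.mul_act _ _ _ _ _ h h'⟩ }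

/-- The orbit space `X/∼_G`; it carries the quotient topology
(instance `instTopologicalSpaceQuotient`). -/
abbrev OrbitSpace (η : PartialAction G X) : Type _ := Quotient η.orbitSetoid

/-- The restriction of a partial action of `G` to a subgroup `H`. Its orbit equivalence relation
is `∼_H`. -/
def restrict (η : PartialAction G X) (H : Subgroup G) : PartialAction H X where
  toPFun p := η.toPFun ((p.1 : G), p.2)
  inv_act g x y h := η.inv_act g x y h
  mul_act g h x y z := η.mul_act g h x y z
  one_act x := η.one_act x

/-! ### The enveloping space and the enveloping action -/

/-- The relation `(g, x) R (h, y)` iff `x ∈ X_{g⁻¹ h}`, that is `(h⁻¹ g) · x` is defined,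
and `(h⁻¹ g) · x = y`. -/
def envSetoid (η : PartialAction G X) : Setoid (G × X) where
  r p q := q.2 ∈ η.toPFun (q.1⁻¹ * p.1, p.2)
  iseqv :=
    { refl := fun p => by simpa using η.one_act p.2
      symm := fun {p q} h => by simpa using η.inv_act _ _ _ h
      trans := fun {p q r} h h' => by simpa [mul_assoc] using η.mul_act _ _ _ _ _ h h' }

/-- The (underlying set of the) enveloping space `X_G = (G × X)/R`. -/
def Env (η : PartialAction G X) : Type _ := Quotient η.envSetoid

/-- The class `[g, x] ∈ X_G`. -/
def envMk (η : PartialAction G X) (g : G) (x : X) : η.Env := Quotient.mk η.envSetoid (g, x)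

theorem envMk_eq_iff (η : PartialAction G X) (g h : G) (x y : X) :
    η.envMk g x = η.envMk h y ↔ y ∈ η.toPFun (h⁻¹ * g, x) :=
  Quotient.eq (r := η.envSetoid)

/-- The enveloping action `μ` of `G` on `X_G`: `g • [h, x] = [g h, x]`. -/
instance envAction (η : PartialAction G X) : MulAction G η.Env where
  smul g := Quotient.lift (fun p : G × X => η.envMk (g * p.1) p.2) (fun p q h =>
    (η.envMk_eq_iff _ _ _ _).2 (by
      have h' : q.2 ∈ η.toPFun (q.1⁻¹ * p.1, p.2) := h
      simpa [mul_assoc] using h'))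
  one_smul := by
    rintro ⟨p⟩
    exact congrArg (fun g => η.envMk g p.2) (one_mul p.1)
  mul_smul := by
    rintro g h ⟨p⟩
    exact congrArg (fun g => η.envMk g p.2) (mul_assoc g h p.1)

theorem smul_envMk (η : PartialAction G X) (g h : G) (x : X) :
    g • η.envMk h x = η.envMk (g * h) x := rfl

end Basic

/-! ### Global actions -/

section Global

variable {G : Type*} {Y : Type*} [Group G] [MulAction G Y]

/-- For a global action of `G` on `Y` and a normal subgroup `H`, the action of `G/H` on the orbit
space `Y/∼_H` given by `gH • (H • y) = H • (g • y)`. -/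
instance quotientMulAction (H : Subgroup G) [H.Normal] :
    MulAction (G ⧸ H) (MulAction.orbitRel.Quotient H Y) where
  smul := Quotient.map₂ (fun (g : G) (y : Y) => g • y) (by
    intro a b hab y z hyz
    have hab' : a⁻¹ * b ∈ H := QuotientGroup.leftRel_apply.1 hab
    obtain ⟨h, hh⟩ : ∃ h : H, h • z = y := hyz
    change ∃ h : H, h • (b • z) = a • y
    refine ⟨⟨a * h * (a⁻¹ * b)⁻¹ * a⁻¹, ?_⟩, ?_⟩
    · have := ‹H.Normal›.conj_mem _ (H.mul_mem h.2 (H.inv_mem hab')) a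
      simpa [mul_assoc] using this
    · rw [← hh]
      simp only [Subgroup.smul_def, smul_smul]
      congr 1
      group)
  one_smul := by
    rintro ⟨y⟩
    exact congrArg (Quotient.mk _) (one_smul G y)
  mul_smul := by
    rintro ⟨a⟩ ⟨b⟩ ⟨y⟩
    exact congrArg (Quotient.mk _) (mul_smul a b y)

/-- The partial action on a subset `S ⊆ Y` induced by a global action of `G` on `Y`:
`S_g = S ∩ g • S`, and `η_g` is the restriction of `y ↦ g • y` to `S_{g⁻¹}`. Thus `g · s` is
defined iff `g • s ∈ S`. -/
def induced (G : Type*) {Y : Type*} [Group G] [MulAction G Y] (S : Set Y) :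
    PartialAction G S where
  toPFun p := ⟨p.1 • (p.2 : Y) ∈ S, fun h => ⟨p.1 • (p.2 : Y), h⟩⟩
  inv_act := by
    rintro g x y ⟨h, rfl⟩
    exact ⟨by simp, Subtype.ext (by simp)⟩
  mul_act := by
    rintro g k x y z ⟨h, rfl⟩ ⟨h', rfl⟩
    exact ⟨by simpa [mul_smul] using h', Subtype.ext (by simp [mul_smul])⟩
  one_act x := ⟨by simp, Subtype.ext (by simp)⟩

/-- Transport of a partial action of `G` on `W` to `Z` along a bijection `e : Z ≃ W`:
`Z_g = e⁻¹(W_g)` and `g · z = e⁻¹(g · e(z))`. -/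
def transport {G Z W : Type*} [Group G] (η : PartialAction G W) (e : Z ≃ W) :
    PartialAction G Z where
  toPFun p := (η.toPFun (p.1, e p.2)).map e.symm
  inv_act := by
    intro g x y h
    obtain ⟨w, hw, rfl⟩ := (Part.mem_map_iff _).1 h
    exact (Part.mem_map_iff _).2 ⟨e x, by simpa using η.inv_act _ _ _ hw, by simp⟩
  mul_act := by
    intro g k x y z h h'
    obtain ⟨w, hw, rfl⟩ := (Part.mem_map_iff _).1 h
    obtain ⟨v, hv, rfl⟩ := (Part.mem_map_iff _).1 h'
    exact (Part.mem_map_iff _).2 ⟨v, η.mul_act _ _ _ _ _ hw (by simpa using hv), rfl⟩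
  one_act x := (Part.mem_map_iff _).2 ⟨e x, η.one_act _, by simp⟩

end Global

/-! ### The partial action of `G/H` on `X/∼_H` -/

section Quotients

variable {G : Type*} {X : Type*} [Group G]

/-- The map `φ : X/∼_H → X_G/∼_H` sending the `H`-orbit of `x` to `H[1, x]`. -/
def orbitMap (η : PartialAction G X) (H : Subgroup G) :
    (η.restrict H).OrbitSpace → MulAction.orbitRel.Quotient H η.Env :=
  Quotient.lift (fun x => Quotient.mk (MulAction.orbitRel H η.Env) (η.envMk 1 x)) (by
    rintro x y ⟨h, hy⟩
    refine Quotient.sound ?_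
    change ∃ k : H, k • η.envMk 1 y = η.envMk 1 x
    refine ⟨h⁻¹, ?_⟩
    rw [Subgroup.smul_def, smul_envMk, envMk_eq_iff]
    simpa using η.inv_act _ _ _ hy)

theorem orbitMap_injective (η : PartialAction G X) (H : Subgroup G) :
    Function.Injective (η.orbitMap H) := by
  rintro ⟨x⟩ ⟨y⟩ h
  obtain ⟨k, hk⟩ : ∃ k : H, k • η.envMk 1 y = η.envMk 1 x := Quotient.exact h
  rw [Subgroup.smul_def, smul_envMk, envMk_eq_iff] at hk
  refine Quotient.sound ⟨k⁻¹, ?_⟩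
  change y ∈ η.toPFun (((k⁻¹ : H) : G), x)
  simpa using η.inv_act _ _ _ hk

/-- The partial action `η_{G/H}` of `G/H` on `X/∼_H`: the enveloping action induces a global action
of `G/H` on `X_G/∼_H`, hence a partial action of `G/H` on the image of `φ`, which is transported to
`X/∼_H` along the bijection `φ : X/∼_H → Im φ`. -/
noncomputable def quotient (η : PartialAction G X) (H : Subgroup G) [H.Normal] :
    PartialAction (G ⧸ H) (η.restrict H).OrbitSpace :=
  (induced (G ⧸ H) (Set.range (η.orbitMap H))).transport
    (Equiv.ofInjective (η.orbitMap H) (η.orbitMap_injective H))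

end Quotients

end PartialAction

/-! Pull the domain of `η.quotient H` back to `G × X`. Since `H[g, x]` meets the copy of `X` in
`X_G` exactly when some `(h g) · x` is defined, the pullback is `{(g, x) | ∃ h ∈ H, (h g, x) ∈ G *
X}` (`mk_mem_quotient_dom_iff`). This is the image of the compact set `H × (G * X)` under the
continuous map `(h, (g, x)) ↦ (h⁻¹ g, x)`, hence compact, hence closed in the Hausdorff space `G ×
X`. Closedness descends to `G/H × X/∼_H` because both projections are open, so that their product is
a quotient map. For `X → X/∼_H` this holds because the saturation of an open `U` is the union of the
open sets `η_h(U)`, `h ∈ H` (`IsTopological.isOpenQuotientMap_mk`). -/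

namespace PartialAction

variable {G : Type*} {X : Type*} [Group G]

/-- `gH · [x]` is defined iff `(h g) · x` is defined for some `h ∈ H`. -/
theorem mk_mem_quotient_dom_iff (η : PartialAction G X) (H : Subgroup G) [H.Normal]
    (g : G) (x : X) :
    ((QuotientGroup.mk g : G ⧸ H), (Quotient.mk _ x : (η.restrict H).OrbitSpace)) ∈
      (η.quotient H).dom ↔ ∃ h : H, ((h : G) * g, x) ∈ η.dom := by
  -- Definitional: transport along `φ` keeps the condition `gH • φ[x] ∈ Im φ`, and the quotient
  -- action computes on representatives.
  have h₁ : ((QuotientGroup.mk g : G ⧸ H), (Quotient.mk _ x : (η.restrict H).OrbitSpace)) ∈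
      (η.quotient H).dom ↔
      ∃ z, η.orbitMap H z = Quotient.mk (MulAction.orbitRel H η.Env) (g • η.envMk 1 x) :=
    Iff.rfl
  rw [h₁]
  constructor
  · rintro ⟨⟨y⟩, hy⟩
    obtain ⟨k, hk⟩ : ∃ k : H, k • (g • η.envMk 1 x) = η.envMk 1 y := Quotient.exact hy
    -- The equality `[k g, x] = [1, y]` in `X_G` says that `(k g) · x = y`.
    rw [Subgroup.smul_def, smul_envMk, smul_envMk, envMk_eq_iff] at hk
    exact ⟨k, (η.mem_dom_iff _).2 ⟨y, by simpa using hk⟩⟩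
  · rintro ⟨k, hk⟩
    obtain ⟨y, hy⟩ := (η.mem_dom_iff _).1 hk
    refine ⟨Quotient.mk _ y, Quotient.sound ?_⟩
    change ∃ k : H, k • (g • η.envMk 1 x) = η.envMk 1 y
    refine ⟨k, ?_⟩
    rw [Subgroup.smul_def, smul_envMk, smul_envMk, envMk_eq_iff]
    simpa using hy

/-- The image of an open set under `η_g` is open. -/
theorem IsTopological.isOpen_setOf_act [TopologicalSpace X] {η : PartialAction G X}
    (hη : η.IsTopological) (g : G) {U : Set X} (hU : IsOpen U) :
    IsOpen {y | ∃ x ∈ U, y ∈ η.toPFun (g, x)} := by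
  -- `η_g` sends the trace of `U` on `X_{g⁻¹}` to an open subset of `X_g`, which is open in `X`
  -- because `X_g` is.
  have h := (hη.isOpen_dom_at g).isOpenMap_subtype_val _
    ((hη.isHomeomorph_actAt g).isOpenMap _ (hU.preimage continuous_subtype_val))
  convert h using 1
  ext y
  constructor
  · rintro ⟨x, hx, hy⟩
    have hd : (g, x) ∈ η.dom := (η.mem_dom_iff _).2 ⟨y, hy⟩
    exact ⟨_, ⟨⟨x, by simpa [dom_at] using hd⟩, hx, rfl⟩,
      Part.mem_unique (η.act_mem ⟨(g, x), hd⟩) hy⟩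
  · rintro ⟨_, ⟨⟨x, hx'⟩, hx, rfl⟩, rfl⟩
    exact ⟨x, hx, η.act_mem ⟨(g, x), by simpa [dom_at] using hx'⟩⟩

/-- The projection of a topological partial action onto the space of orbits of a subgroup is an
open quotient map. -/
theorem IsTopological.isOpenQuotientMap_mk [TopologicalSpace X] {η : PartialAction G X}
    (hη : η.IsTopological) (H : Subgroup G) :
    IsOpenQuotientMap (Quotient.mk _ : X → (η.restrict H).OrbitSpace) := by
  refine ⟨Quotient.mk_surjective, continuous_quotient_mk', fun U hU => ?_⟩
  rw [← isQuotientMap_quotient_mk'.isOpen_preimage]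
  convert isOpen_iUnion fun h : H => hη.isOpen_setOf_act (h : G) hU using 1
  ext y
  rw [Set.mem_iUnion]
  constructor
  · rintro ⟨x, hx, hxy⟩
    obtain ⟨h, hh⟩ := Quotient.exact hxy
    exact ⟨h, x, hx, hh⟩
  · rintro ⟨h, x, hx, hy⟩
    exact ⟨x, hx, Quotient.sound ⟨h, hy⟩⟩

end PartialAction

theorem mainTheorem8 {G : Type*} {X : Type*}
    [Group G] [TopologicalSpace G] [IsTopologicalGroup G] [CompactSpace G] [T2Space G]
    [TopologicalSpace X] [CompactSpace X] [T2Space X]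
    (H : Subgroup G) [H.Normal] (hH : IsClosed (H : Set G))
    (η : PartialAction G X) (hη_top : η.IsTopological) (hη_cont : η.IsContinuous)
    (hη_closed : IsClosed η.dom) :
    IsClosed (η.quotient H).dom := by
  -- Openness of the factors matters here: a product of arbitrary quotient maps need not be a
  -- quotient map.
  have hq : IsOpenQuotientMap (Prod.map (QuotientGroup.mk : G → G ⧸ H)
      (Quotient.mk _ : X → (η.restrict H).OrbitSpace)) :=
    QuotientGroup.isOpenQuotientMap_mk.prodMap (hη_top.isOpenQuotientMap_mk H)
  rw [← hq.isQuotientMap.isClosed_preimage]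
  have hK : IsCompact ((H : Set G) ×ˢ η.dom) := hH.isCompact.prod hη_closed.isCompact
  have hf : Continuous fun p : G × (G × X) => (p.1⁻¹ * p.2.1, p.2.2) := by fun_prop
  convert (hK.image hf).isClosed using 1
  ext ⟨g, x⟩
  refine (η.mk_mem_quotient_dom_iff H g x).trans ⟨?_, ?_⟩
  · rintro ⟨h, hd⟩
    -- `(g, x)` is recovered from the point `(h g, x)` of the domain, as `h⁻¹ (h g) = g`.
    exact ⟨(h, (h * g, x)), ⟨h.2, hd⟩, by simp⟩
  · rintro ⟨⟨h, g', x'⟩, ⟨hh, hd⟩, he⟩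
    obtain ⟨rfl, rfl⟩ := Prod.mk.inj he
    exact ⟨⟨h, hh⟩, by simpa using hd⟩
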